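/- Call a strict total order $O$ on $\mathbb N=\{1,2,\dots\}$ simply an order, and let $\mathcal O$ be the space of orders with the $\sigma$-algebra generated by the events "$i$ precedes $j$". For $n\ge 1$ let $\pi_n(O)\in\mathfrak S_n$ be the permutation whose one-line notation $\sigma(1)\dots\sigma(n)$ lists $1,\dots,n$ in the order $O$. A position $j$ is a record of $\sigma\in\mathfrak S_n$ if $\sigma(j)=\max_{i\le j}\sigma(i)$. Let $\alpha=(\alpha_k)_{k\ge1}$ be a sequence in $\{1,2,\dots\}\cup\{+\infty\}$ such that for every $k$ either $\alpha_k<\alpha_{k+1}$ or $\alpha_k=\alpha_{k+1}=+\infty$, and $\sum_k 1/\alpha_k<\infty$ (with $1/\infty=0$). Let $0<p\le 1$. The measure $P^{(\alpha,p)}$ on $\mathcal O$ is defined as follows. - $P^*$ is the law of the order in which $i$ precedes $j$ iff $\xi_i<\xi_j$, where $\xi_1,\xi_2,\dots$ are i.i.d. uniform on $[0,1]$. - Let $r_1,r_2,\dots$ be independent, with $r_i$ uniform on $\{1,\dots,i-1\}$ if $i=\alpha_k+1$ for some $k$, and $r_i=i$ otherwise. Put $r_{i,i}=r_i$ and $r_{i,j+1}=r_{i,j}+\mathbf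 1(r_{j+1}\le r_{i,j})$ for $j\ge i$. Almost surely $\sigma(i)=\lim_{j\to\infty}r_{i,j}$ defines a bijection $\sigma:\mathbb N\to\mathbb N$, and $P^{(\alpha,1)}$ is the law of the order in which $i$ precedes $j$ iff $\sigma^{-1}(i)<\sigma^{-1}(j)$. - Assign each positive integer independently to $N_1$ with probability $p$ and to $N_2$ with probability $1-p$. Let every element of $N_1$ precede every element of $N_2$; independently order $N_1$ according to $P^{(\alpha,1)}$ and $N_2$ according to $P^*$, where elements of $N_1$ (resp. $N_2$) are identified with their indices in the increasing enumeration of $N_1$ (resp. $N_2$). The law of the resulting order is $P^{(\alpha,p)}$. Let $O$ be a random element of $\mathcal O$ with distribution $P^{(\alpha,p)}$. Then (i) almost surely, for every $k\ge1$, the $k$-th smallest non-record position of $\pi_n(O)$ (taken to be $+\infty$ if $\pi_n(O)$ has fewer than $k$ non-record positions) converges to $\alpha_k+1$ in $\mathbb N\cup\{+\infty\}$ as $n\to\infty$; that is, it exists and equals $\alpha_k+1$ for all large $n$ if $\alpha_k<\infty$, and it tends to $+\infty$ if $\alpha_k=+\infty$; (ii) almost surely, $$\liminf_{n\to\infty}\frac{(\pi_n(O))^{-1}(n)}{n}=p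 .$$ -/

import Mathlib

open MeasureTheory ProbabilityTheory Filter Topology
open scoped ENNReal

/-! Conventions. All index sets are zero-based: the number `i : ℕ` stands for the letter, position or
rank `i + 1` of the usual one-based description, and `Fin n` stands for `{1, …, n}`. Whenever the
numerical value of a position matters, `1` is added back explicitly. -/

/-- A (strict) total order on the natural numbers; `O.lt i j` means that `i` precedes `j`. -/
structure NatOrder where
  lt : ℕ → ℕ → Prop
  strictTotal : IsStrictTotalOrder ℕ lt

namespace NatOrder

/-- The σ-algebra generated by the events that `i` precedes `j`. It is the Borel σ-algebra of the
space of orders, regarded as the projective limit of the finite symmetric groups. -/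
instance : MeasurableSpace NatOrder :=
  MeasurableSpace.comap (fun (O : NatOrder) (i j : ℕ) => O.lt i j) inferInstance

lemma measurable_of_lt {X : Type*} [MeasurableSpace X] {f : X → NatOrder}
    (hf : ∀ i j, MeasurableSet {x | (f x).lt i j}) : Measurable f := by
  rw [measurable_comap_iff]
  refine measurable_pi_lambda _ fun i => measurable_pi_lambda _ fun j => ?_
  exact measurableSet_setOfPred.1 (hf i j)

lemma measurableSet_precedes (i j : ℕ) : MeasurableSet {O : NatOrder | O.lt i j} := by
  have h : Measurable (fun (O : NatOrder) (i j : ℕ) => O.lt i j) := comap_measurable _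
  exact measurableSet_setOfPred.2 ((measurable_pi_apply j).comp ((measurable_pi_apply i).comp h))

/-- The order on `ℕ` defined by a bijection `σ`: `a` precedes `b` iff `σ⁻¹ a < σ⁻¹ b`. -/
def ofPerm (σ : Equiv.Perm ℕ) : NatOrder where
  lt a b := σ.symm a < σ.symm b
  strictTotal :=
    { trichotomous := fun a b h1 h2 => σ.symm.injective (by omega)
      irrefl := fun a => lt_irrefl _
      trans := fun a b c h1 h2 => lt_trans h1 h2 }

/-- The number of elements of `{0, …, n-1}` that strictly precede `i`. -/
noncomputable def place (O : NatOrder) (n : ℕ) (i : Fin n) : ℕ :=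
  {j : Fin n | O.lt j i}.ncard

lemma place_lt_of_lt (O : NatOrder) {n : ℕ} {i j : Fin n} (h : O.lt i j) :
    O.place n i < O.place n j := by
  have := O.strictTotal
  refine Set.ncard_lt_ncard ?_ (Set.toFinite _)
  refine ⟨fun k hk => _root_.trans (r := O.lt) hk h, fun hs => ?_⟩
  exact irrefl (r := O.lt) _ (hs (show i ∈ {k : Fin n | O.lt k j} from h))

lemma place_lt (O : NatOrder) (n : ℕ) (i : Fin n) : O.place n i < n := by
  have := O.strictTotal
  have h : {j : Fin n | O.lt j i}.ncard < (Set.univ : Set (Fin n)).ncard := by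
    refine Set.ncard_lt_ncard ⟨Set.subset_univ _, fun hs => ?_⟩ (Set.toFinite _)
    exact irrefl (r := O.lt) _ (hs (Set.mem_univ i))
  simpa [place] using h

lemma place_bijective (O : NatOrder) (n : ℕ) :
    Function.Bijective (fun i : Fin n => (⟨O.place n i, O.place_lt n i⟩ : Fin n)) := by
  have := O.strictTotal
  refine Finite.injective_iff_bijective.1 fun i j hij => ?_
  have hij' : O.place n i = O.place n j := congrArg Fin.val hij
  have h1 : ¬ O.lt i j := fun h => (O.place_lt_of_lt h).ne hij'
  have h2 : ¬ O.lt j i := fun h => (O.place_lt_of_lt h).ne hij'.symm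
  exact Fin.ext (this.trichotomous _ _ h1 h2)

/-- The restriction `π_n(O)` of the order `O` to the first `n` natural numbers, regarded as a
permutation `σ` of `Fin n` in one-line notation: `σ` lists the first `n` natural numbers in the
order `O`, so that `i` precedes `j` iff `σ⁻¹ i < σ⁻¹ j`. -/
noncomputable def proj (O : NatOrder) (n : ℕ) : Equiv.Perm (Fin n) :=
  (Equiv.ofBijective _ (O.place_bijective n)).symm

lemma proj_inv_lt_iff (O : NatOrder) (n : ℕ) (i j : Fin n) :
    (O.proj n)⁻¹ i < (O.proj n)⁻¹ j ↔ O.lt i j := by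
  have := O.strictTotal
  change O.place n i < O.place n j ↔ _
  refine ⟨fun h => ?_, O.place_lt_of_lt⟩
  by_contra hn
  by_cases hji : O.lt j i
  · exact absurd h (O.place_lt_of_lt hji).le.not_gt
  · have : i = j := Fin.ext (this.trichotomous _ _ hn hji)
    exact absurd h (this ▸ lt_irrefl _)

end NatOrder

/-- Position `j` is an (upper) record of `σ` if `σ j = max_{i ≤ j} σ i`. -/
def IsRecord {n : ℕ} (σ : Equiv.Perm (Fin n)) (j : Fin n) : Prop :=
  ∀ i ≤ j, σ i ≤ σ j

/-- The `(k+1)`-st smallest non-record position of `σ`, as a one-based position. It is `⊤` (the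
infimum of the empty family) if `σ` has at most `k` non-record positions; otherwise exactly one `j`
contributes to the infimum. -/
noncomputable def nonRecordPosition {n : ℕ} (σ : Equiv.Perm (Fin n)) (k : ℕ) : ℕ∞ :=
  ⨅ (j : Fin n) (_ : ¬ IsRecord σ j ∧ {i : Fin n | i < j ∧ ¬ IsRecord σ i}.ncard = k),
    ((j : ℕ) : ℕ∞) + 1

/-! ### The exchangeable order -/

/-- The order in which `i` precedes `j` iff `ξ i < ξ j`; ties, which have probability zero below,
are broken by the natural order. -/
def NatOrder.ofKeys (ξ : ℕ → unitInterval) : NatOrder where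
  lt i j := ξ i < ξ j ∨ (ξ i = ξ j ∧ i < j)
  strictTotal :=
    { trichotomous := fun a b h1 h2 => by
        push Not at h1 h2
        have h : ξ a = ξ b := le_antisymm h2.1 h1.1
        exact le_antisymm (h2.2 h.symm) (h1.2 h)
      irrefl := fun a h => by simp at h
      trans := fun a b c h1 h2 => by
        rcases h1 with h1 | ⟨h1, h1'⟩ <;> rcases h2 with h2 | ⟨h2, h2'⟩
        · exact Or.inl (h1.trans h2)
        · exact Or.inl (h2 ▸ h1)
        · exact Or.inl (h1 ▸ h2)
        · exact Or.inr ⟨h1.trans h2, h1'.trans h2'⟩ }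

lemma NatOrder.measurable_ofKeys : Measurable NatOrder.ofKeys := by
  refine NatOrder.measurable_of_lt fun i j => ?_
  have hi : Measurable fun ξ : ℕ → unitInterval => ξ i := measurable_pi_apply i
  have hj : Measurable fun ξ : ℕ → unitInterval => ξ j := measurable_pi_apply j
  exact (measurableSet_lt hi hj).union ((measurableSet_eq_fun hi hj).inter (.const _))

/-- The measure `P^*`: the law of the order induced by an i.i.d. sequence of uniform random
variables on the unit interval. -/
noncomputable def exchangeableMeasure : Measure NatOrder :=
  (Measure.infinitePi fun _ : ℕ => (volume : Measure unitInterval)).map NatOrder.ofKeys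

instance : IsProbabilityMeasure exchangeableMeasure :=
  Measure.isProbabilityMeasure_map NatOrder.measurable_ofKeys.aemeasurable

/-! ### The measures `P^(α,1)` -/

/-- The array `r_{i,j}`, `j ≥ i`, generated by a sequence of ranks: `rankArray r i d` is
`r_{i,i+d}`, so that `r_{i,i} = r_i` and `r_{i,j+1} = r_{i,j} + 1(r_{j+1} ≤ r_{i,j})`. -/
def rankArray (r : (i : ℕ) → Fin (i + 1)) (i : ℕ) : ℕ → ℕ
  | 0 => r i
  | d + 1 => rankArray r i d + if (r (i + d + 1) : ℕ) ≤ rankArray r i d then 1 else 0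

open Classical in
/-- The order given by the bijection `σ i = lim_{j → ∞} r_{i,j}`. Sequences of ranks that do not
define a bijection, which have probability zero below, are sent to the natural order. -/
noncomputable def NatOrder.ofRanks (r : (i : ℕ) → Fin (i + 1)) : NatOrder :=
  if h : ∃ σ : Equiv.Perm ℕ, ∀ i, Tendsto (rankArray r i) atTop (𝓝 (σ i)) then
    NatOrder.ofPerm h.choose
  else NatOrder.ofPerm (Equiv.refl ℕ)

open Classical in
/-- The law of the rank at (one-based) position `i + 1`: uniform on the `i` ranks that are not
maximal if `i` is a term of `α`, and the maximal rank otherwise. -/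
noncomputable def rankLaw (α : ℕ → ℕ∞) : (i : ℕ) → PMF (Fin (i + 1))
  | 0 => PMF.pure 0
  | i + 1 =>
    if ∃ k, α k = ((i + 1 : ℕ) : ℕ∞) then
      (PMF.uniformOfFintype (Fin (i + 1))).map Fin.castSucc
    else PMF.pure (Fin.last (i + 1))

lemma measurable_rankArray (i d : ℕ) :
    Measurable fun r : (i : ℕ) → Fin (i + 1) => rankArray r i d := by
  have hr (i : ℕ) : Measurable fun r : (i : ℕ) → Fin (i + 1) => (r i : ℕ) :=
    (measurable_of_countable (fun x : Fin (i + 1) => (x : ℕ))).comp (measurable_pi_apply i)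
  induction d with
  | zero => exact hr i
  | succ d ih =>
    exact ih.add (Measurable.ite (measurableSet_le (hr _) ih) measurable_const measurable_const)

lemma measurableSet_tendsto_rankArray (i a : ℕ) :
    MeasurableSet {r : (i : ℕ) → Fin (i + 1) | Tendsto (rankArray r i) atTop (𝓝 a)} := by
  have h : {r : (i : ℕ) → Fin (i + 1) | Tendsto (rankArray r i) atTop (𝓝 a)} =
      ⋃ N : ℕ, ⋂ n : ℕ, ⋂ _ : N ≤ n, {r | rankArray r i n = a} := by
    ext r
    simp [nhds_discrete, eventually_atTop]
  rw [h]
  exact .iUnion fun N => .iInter fun n => .iInter fun _ =>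
    measurableSet_eq_fun (measurable_rankArray i n) measurable_const

lemma NatOrder.measurable_ofRanks : Measurable NatOrder.ofRanks := by
  let L (i a : ℕ) : Set ((i : ℕ) → Fin (i + 1)) := {r | Tendsto (rankArray r i) atTop (𝓝 a)}
  have hL (i a : ℕ) : MeasurableSet (L i a) := measurableSet_tendsto_rankArray i a
  let G : Set ((i : ℕ) → Fin (i + 1)) :=
    {r | ∃ σ : Equiv.Perm ℕ, ∀ i, Tendsto (rankArray r i) atTop (𝓝 (σ i))}
  have hG : MeasurableSet G := by
    have hGe : G = (⋂ i, ⋃ a, L i a) ∩ (⋂ a, ⋃ i, L i a) ∩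
        (⋂ i, ⋂ j, ⋂ a, ⋂ _ : i ≠ j, (L i a ∩ L j a)ᶜ) := by
      ext r
      simp only [Set.mem_inter_iff, Set.mem_iInter, Set.mem_iUnion, Set.mem_compl_iff]
      constructor
      · rintro ⟨σ, hσ⟩
        refine ⟨⟨fun i => ⟨σ i, hσ i⟩, fun a => ⟨σ.symm a, ?_⟩⟩, fun i j a hij h => hij ?_⟩
        · simpa [L] using hσ (σ.symm a)
        · exact σ.injective ((tendsto_nhds_unique (hσ i) h.1).trans
            (tendsto_nhds_unique (hσ j) h.2).symm)
      · rintro ⟨⟨h1, h2⟩, h3⟩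
        choose f hf using h1
        refine ⟨Equiv.ofBijective f ⟨fun i j hij => ?_, fun a => ?_⟩, hf⟩
        · by_contra hne
          exact h3 i j (f i) hne ⟨hf i, hij ▸ hf j⟩
        · obtain ⟨i, hi⟩ := h2 a
          exact ⟨i, tendsto_nhds_unique (hf i) hi⟩
    rw [hGe]
    refine ((MeasurableSet.iInter fun i => .iUnion fun a => hL i a).inter
      (.iInter fun a => .iUnion fun i => hL i a)).inter ?_
    exact .iInter fun i => .iInter fun j => .iInter fun a => .iInter fun _ =>
      ((hL i a).inter (hL j a)).compl
  refine NatOrder.measurable_of_lt fun a b => ?_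
  have he : {r | (NatOrder.ofRanks r).lt a b} =
      (G ∩ ⋃ i, ⋃ j, ⋃ _ : i < j, L i a ∩ L j b) ∪ (Gᶜ ∩ {_r | a < b}) := by
    ext r
    by_cases h : r ∈ G
    · have h' : ∃ σ : Equiv.Perm ℕ, ∀ i, Tendsto (rankArray r i) atTop (𝓝 (σ i)) := h
      have hc := h'.choose_spec
      have e : NatOrder.ofRanks r = NatOrder.ofPerm h'.choose := by
        rw [NatOrder.ofRanks, dif_pos h']
      generalize h'.choose = σ at hc e
      simp only [Set.mem_ofPred_eq, e, Set.mem_union, Set.mem_inter_iff, h, true_and,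
        Set.mem_iUnion, Set.mem_compl_iff, not_true, false_and, or_false]
      constructor
      · intro hab
        refine ⟨σ.symm a, σ.symm b, hab, ?_, ?_⟩
        · simpa [L] using hc (σ.symm a)
        · simpa [L] using hc (σ.symm b)
      · rintro ⟨i, j, hij, hi, hj⟩
        have ha : σ i = a := tendsto_nhds_unique (hc i) hi
        have hb : σ j = b := tendsto_nhds_unique (hc j) hj
        subst ha hb
        simpa [NatOrder.ofPerm] using hij
    · have h' : ¬ ∃ σ : Equiv.Perm ℕ, ∀ i, Tendsto (rankArray r i) atTop (𝓝 (σ i)) := h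
      have e : NatOrder.ofRanks r = NatOrder.ofPerm (Equiv.refl ℕ) := by
        rw [NatOrder.ofRanks, dif_neg h']
      simp [e, h, NatOrder.ofPerm]
  rw [he]
  exact (hG.inter (.iUnion fun i => .iUnion fun j => .iUnion fun _ =>
    (hL i a).inter (hL j b))).union (hG.compl.inter (.const _))

/-- The measure `P^(α,1)`: the law of the order generated by independent ranks. -/
noncomputable def rankMeasure (α : ℕ → ℕ∞) : Measure NatOrder :=
  (Measure.infinitePi fun i : ℕ => (rankLaw α i).toMeasure).map NatOrder.ofRanks

instance (α : ℕ → ℕ∞) : IsProbabilityMeasure (rankMeasure α) :=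
  Measure.isProbabilityMeasure_map NatOrder.measurable_ofRanks.aemeasurable

/-! ### The measures `P^(α,p)` -/

/-- Let `N₁` be the set of `i` with `s i = true` and `N₂` its complement. In the combined order
every element of `N₁` precedes every element of `N₂`, and `N₁` (respectively `N₂`) is ordered by
`O₁` (respectively `O₂`) after replacing each of its elements by its index in the increasing
enumeration of `N₁` (respectively `N₂`). -/
def NatOrder.combine (s : ℕ → Bool) (O₁ O₂ : NatOrder) : NatOrder where
  lt i j := (s i = true ∧ s j = false) ∨
    (s i = true ∧ s j = true ∧ O₁.lt (Nat.count (s · = true) i) (Nat.count (s · = true) j)) ∨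
    (s i = false ∧ s j = false ∧ O₂.lt (Nat.count (s · = false) i) (Nat.count (s · = false) j))
  strictTotal := by
    have h1 := O₁.strictTotal
    have h2 := O₂.strictTotal
    refine
      { trichotomous := fun a b hab hba => ?_
        irrefl := fun a h => ?_
        trans := fun a b c hab hbc => ?_ }
    · rcases ha : s a <;> rcases hb : s b <;> simp [ha, hb] at hab hba
      · exact Nat.count_injective (p := (s · = false)) ha hb (h2.trichotomous _ _ hab hba)
      · exact Nat.count_injective (p := (s · = true)) ha hb (h1.trichotomous _ _ hab hba)
    · rcases ha : s a <;> simp [ha] at h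
      · exact irrefl (r := O₂.lt) _ h
      · exact irrefl (r := O₁.lt) _ h
    · rcases ha : s a <;> rcases hb : s b <;> rcases hc : s c <;> simp [ha, hb, hc] at hab hbc ⊢
      · exact _root_.trans (r := O₂.lt) hab hbc
      · exact _root_.trans (r := O₁.lt) hab hbc

lemma NatOrder.measurable_combine :
    Measurable fun x : (ℕ → Bool) × NatOrder × NatOrder => NatOrder.combine x.1 x.2.1 x.2.2 := by
  refine NatOrder.measurable_of_lt fun i j => ?_
  have hs (i : ℕ) (b : Bool) :
      MeasurableSet {x : (ℕ → Bool) × NatOrder × NatOrder | x.1 i = b} :=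
    measurableSet_eq_fun ((measurable_pi_apply i).comp measurable_fst) measurable_const
  have hcount (b : Bool) (i m : ℕ) :
      MeasurableSet {x : (ℕ → Bool) × NatOrder × NatOrder | Nat.count (x.1 · = b) i = m} := by
    have : Measurable fun x : (ℕ → Bool) × NatOrder × NatOrder => Nat.count (x.1 · = b) i := by
      induction i with
      | zero => simp
      | succ i ih =>
        simp only [Nat.count_succ]
        exact ih.add (Measurable.ite (hs i b) measurable_const measurable_const)
    exact measurableSet_eq_fun this measurable_const
  have hlt (b : Bool) (f : (ℕ → Bool) × NatOrder × NatOrder → NatOrder) (hf : Measurable f) :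
      MeasurableSet {x : (ℕ → Bool) × NatOrder × NatOrder |
        (f x).lt (Nat.count (x.1 · = b) i) (Nat.count (x.1 · = b) j)} := by
    have : {x : (ℕ → Bool) × NatOrder × NatOrder |
        (f x).lt (Nat.count (x.1 · = b) i) (Nat.count (x.1 · = b) j)} =
        ⋃ m, ⋃ n, {x | Nat.count (x.1 · = b) i = m} ∩ {x | Nat.count (x.1 · = b) j = n} ∩
          f ⁻¹' {O | O.lt m n} := by
      ext x
      simp
    rw [this]
    exact .iUnion fun m => .iUnion fun n =>
      ((hcount b i m).inter (hcount b j n)).inter (hf (NatOrder.measurableSet_precedes m n))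
  exact ((hs i true).inter (hs j false)).union
    (((hs i true).inter ((hs j true).inter (hlt true _ (measurable_fst.comp measurable_snd)))).union
      ((hs i false).inter ((hs j false).inter
        (hlt false _ (measurable_snd.comp measurable_snd)))))

/-- The measure `P^(α,p)`: every natural number is assigned to `N₁` with probability `p` and to `N₂`
with probability `1 - p`, independently; `N₁` precedes `N₂`, and, given the splitting, `N₁` and `N₂`
are ordered independently according to `P^(α,1)` and `P^*`, respectively. -/
noncomputable def mixedMeasure (α : ℕ → ℕ∞) (p : unitInterval) : Measure NatOrder :=
  ((Measure.infinitePi fun _ : ℕ => bernoulliMeasure true false p).prod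
    ((rankMeasure α).prod exchangeableMeasure)).map
      fun x => NatOrder.combine x.1 x.2.1 x.2.2

instance (α : ℕ → ℕ∞) (p : unitInterval) : IsProbabilityMeasure (mixedMeasure α p) :=
  Measure.isProbabilityMeasure_map NatOrder.measurable_combine.aemeasurable

/-! Both claims follow from an almost sure property of the ranks, `HasSparseLowRanks`: for every ε >
0 and all large y, at most ε·y of the non-maximal ranks are ≤ 2y. The expected number of non-maximal
ranks ≤ z is at most (z+1)·∑ min(1/(z+1), 1/a) over the finite terms a of α, which is o(z) by
dominated convergence since ∑ 1/α_k < ∞. A Chernoff bound and Borel–Cantelli make this almost sure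
(`ae_hasSparseLowRanks`).

From there on the argument is deterministic. The rank of position i grows only when a later
non-maximal rank lands at or below it. Sparsity therefore bounds this growth, makes the limit σ a
bijection (`HasSparseLowRanks.exists_perm`) and gives σ(i) ≤ (1+ε)·r_i when σ(i) is large
(`HasSparseLowRanks.eventually_limit_le`).

For (i), N₁ is infinite and is listed first, so each initial stretch of π_n is eventually the
corresponding stretch of N₁. The records there are those of σ, and σ has a record at i exactly when
r_i is maximal, that is, when i is not a term of α.

For (ii), let c(n) ~ pn count the elements of N₁ below n. If n lies in N₂, all of these precede it.
If n lies in N₁, exactly r_i smaller numbers precede it, where σ(i) = c(n), and c(n)/(1+ε) ≤ r_i ≤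
c(n) for large n. So the liminf is at least p, and the elements of N₁ show that it is at most p. The
internal order of N₂ plays no role. -/

/-! ### The ranks at a fixed time -/

/-- The rank of position `i` among the positions `0, …, n`. -/
def rankAt (r : (i : ℕ) → Fin (i + 1)) (n i : ℕ) : ℕ := rankArray r i (n - i)

section Ranks

variable (r : (i : ℕ) → Fin (i + 1))

lemma rankAt_self (n : ℕ) : rankAt r n n = r n := by
  simp [rankAt, rankArray]

lemma rankAt_succ {n i : ℕ} (h : i ≤ n) :
    rankAt r (n + 1) i = rankAt r n i + if (r (n + 1) : ℕ) ≤ rankAt r n i then 1 else 0 := by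
  obtain ⟨d, rfl⟩ := Nat.exists_eq_add_of_le h
  have h1 : i + d + 1 - i = d + 1 := by omega
  have h2 : i + d - i = d := by omega
  simp only [rankAt, h1, h2, rankArray]

lemma rankAt_le {n i : ℕ} (h : i ≤ n) : rankAt r n i ≤ n := by
  induction n, h using Nat.le_induction with
  | base => rw [rankAt_self]; omega
  | succ n hn ih => rw [rankAt_succ r hn]; split_ifs <;> omega

lemma rankAt_lt_succ_iff {n i j : ℕ} (hi : i ≤ n) (hj : j ≤ n) :
    rankAt r (n + 1) i < rankAt r (n + 1) j ↔ rankAt r n i < rankAt r n j := by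
  rw [rankAt_succ r hi, rankAt_succ r hj]
  split_ifs <;> omega

lemma rankAt_lt_iff_of_le {m n i j : ℕ} (hi : i ≤ m) (hj : j ≤ m) (hmn : m ≤ n) :
    rankAt r n i < rankAt r n j ↔ rankAt r m i < rankAt r m j := by
  induction n, hmn using Nat.le_induction with
  | base => rfl
  | succ n hn ih => rw [rankAt_lt_succ_iff r (hi.trans hn) (hj.trans hn), ih]

lemma rankAt_succ_ne {n i : ℕ} (hi : i ≤ n) : rankAt r (n + 1) i ≠ rankAt r (n + 1) (n + 1) := by
  rw [rankAt_self, rankAt_succ r hi]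
  split_ifs <;> omega

lemma rankAt_ne {n i j : ℕ} (hij : i < j) (hj : j ≤ n) : rankAt r n i ≠ rankAt r n j := by
  induction n, hj using Nat.le_induction with
  | base =>
    obtain _ | j := j
    · omega
    · exact rankAt_succ_ne r (by omega)
  | succ n hn ih =>
    have h1 := rankAt_lt_succ_iff r (hij.le.trans hn) hn
    have h2 := rankAt_lt_succ_iff r hn (hij.le.trans hn)
    omega

lemma rankAt_injOn (n : ℕ) : Set.InjOn (rankAt r n) (Finset.range (n + 1)) := by
  intro i hi j hj hij
  simp only [Finset.coe_range, Set.mem_Iio] at hi hj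
  rcases lt_trichotomy i j with h | h | h
  · exact absurd hij (rankAt_ne r h (by omega))
  · exact h
  · exact absurd hij.symm (rankAt_ne r h (by omega))

lemma image_rankAt (n : ℕ) :
    (Finset.range (n + 1)).image (rankAt r n) = Finset.range (n + 1) := by
  refine Finset.eq_of_subset_of_card_le (fun v hv => ?_) ?_
  · obtain ⟨i, hi, rfl⟩ := Finset.mem_image.1 hv
    have := rankAt_le r (Nat.lt_succ_iff.1 (Finset.mem_range.1 hi))
    simp; omega
  · rw [Finset.card_image_of_injOn (rankAt_injOn r n)]

/-- The ranks at time i are a permutation of 0, …, i, so exactly r_i of them are below r_i, and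
position i itself is not among these. -/
lemma card_rankAt_lt (i : ℕ) :
    ((Finset.range i).filter fun j => rankAt r i j < r i).card = r i := by
  have h1 : (Finset.range i).filter (fun j => rankAt r i j < r i) =
      (Finset.range (i + 1)).filter fun j => rankAt r i j < r i := by
    rw [Finset.range_add_one, Finset.filter_insert, if_neg]
    simp [rankAt_self]
  have h2 : ((Finset.range (i + 1)).filter fun j => rankAt r i j < r i).image (rankAt r i) =
      Finset.range (r i) := by
    rw [← Finset.filter_image (p := fun v => v < (r i : ℕ)), image_rankAt]
    ext v
    have := (r i).2
    simp; omega
  rw [h1, ← Finset.card_image_of_injOn ((rankAt_injOn r i).mono (by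
    simp only [Finset.coe_filter]; intro x hx; simpa using hx.1)), h2,
    Finset.card_range]

/-- The number of positions `a < n` that are not maximal when they are inserted and whose initial
rank is at most `z`. -/
def lowRankCount (z n : ℕ) : ℕ :=
  ((Finset.range n).filter fun a => (r a : ℕ) < a ∧ (r a : ℕ) ≤ z).card

lemma lowRankCount_succ (z n : ℕ) : lowRankCount r z (n + 1) =
    lowRankCount r z n + if (r n : ℕ) < n ∧ (r n : ℕ) ≤ z then 1 else 0 := by
  rw [lowRankCount, Finset.range_add_one, Finset.filter_insert]
  split_ifs with h
  · rw [Finset.card_insert_of_notMem (by simp), lowRankCount]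
  · rfl

/-- A bootstrap: while the rank of i is at most 2y, each increment comes from a non-maximal rank ≤
2y and is counted by `lowRankCount`. Fewer than or exactly y such increments, from a start at most
y, never push the rank beyond 2y. -/
lemma rankAt_add_le {i y : ℕ} (hy : (r i : ℕ) ≤ y) (hc : ∀ n, lowRankCount r (2 * y) n ≤ y)
    {n : ℕ} (hn : i ≤ n) : rankAt r n i ≤ r i + lowRankCount r (2 * y) (n + 1) := by
  induction n, hn using Nat.le_induction with
  | base => rw [rankAt_self]; omega
  | succ n hn ih =>
    have h1 := hc (n + 1)
    have h2 := rankAt_le r hn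
    rw [rankAt_succ r hn, lowRankCount_succ]
    split_ifs <;> omega

/-- A sequence of ranks in which non-maximal low ranks are asymptotically negligible. -/
def HasSparseLowRanks : Prop :=
  ∀ ε : ℝ, 0 < ε → ∀ᶠ y : ℕ in atTop, ∀ n, (lowRankCount r (2 * y) n : ℝ) ≤ ε * y

variable {r}

lemma HasSparseLowRanks.exists_forall_le (hr : HasSparseLowRanks r) (v : ℕ) :
    ∃ y, v ≤ y ∧ ∀ n, lowRankCount r (2 * y) n ≤ y := by
  obtain ⟨y, h1, h2⟩ := ((hr 1 one_pos).and (eventually_ge_atTop v)).exists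
  refine ⟨y, h2, fun n => ?_⟩
  have := h1 n
  rw [one_mul] at this
  exact_mod_cast this

/-- Only finitely many positions have a non-maximal rank ≤ 2y, where y ≥ v. Any other n has either
r_n = n or r_n > 2y. -/
lemma HasSparseLowRanks.eventually_lt (hr : HasSparseLowRanks r) (v : ℕ) :
    ∀ᶠ n in atTop, v < (r n : ℕ) := by
  obtain ⟨y, hvy, hy⟩ := hr.exists_forall_le v
  have hfin : {a : ℕ | (r a : ℕ) < a ∧ (r a : ℕ) ≤ 2 * y}.Finite := by
    by_contra hinf
    obtain ⟨t, ht, hcard⟩ := (Set.not_finite.1 hinf).exists_subset_card_eq (y + 1)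
    have hsub : t ⊆ (Finset.range (t.sup id + 1)).filter
        fun a => (r a : ℕ) < a ∧ (r a : ℕ) ≤ 2 * y := by
      intro a ha
      rw [Finset.mem_filter, Finset.mem_range]
      exact ⟨Nat.lt_succ_of_le (Finset.le_sup (f := id) ha), ht ha⟩
    have h1 := Finset.card_le_card hsub
    have h2 := hy (t.sup id + 1)
    rw [lowRankCount] at h2
    omega
  filter_upwards [Nat.cofinite_eq_atTop ▸ hfin.eventually_cofinite_notMem, eventually_gt_atTop v]
    with n h1 h2
  have h3 : ¬ ((r n : ℕ) < n ∧ (r n : ℕ) ≤ 2 * y) := h1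
  omega

lemma rankAt_mono {i m n : ℕ} (h1 : i ≤ m) (h2 : m ≤ n) : rankAt r m i ≤ rankAt r n i := by
  induction n, h2 using Nat.le_induction with
  | base => rfl
  | succ n hn ih => rw [rankAt_succ r (h1.trans hn)]; omega

lemma tendsto_rankArray_iff {i a : ℕ} :
    Tendsto (rankArray r i) atTop (𝓝 a) ↔ ∀ᶠ n in atTop, rankAt r n i = a := by
  rw [nhds_discrete, tendsto_pure]
  constructor
  · intro h
    exact (tendsto_sub_atTop_nat i).eventually h
  · intro h
    filter_upwards [(tendsto_add_atTop_nat i).eventually h] with n hn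
    simpa [rankAt] using hn

lemma HasSparseLowRanks.exists_limit (hr : HasSparseLowRanks r) (i : ℕ) :
    ∃ a, ∀ᶠ n in atTop, rankAt r n i = a := by
  obtain ⟨y, h1, h2⟩ := hr.exists_forall_le (r i)
  have hb : ∀ n, i ≤ n → rankAt r n i ≤ 2 * y := fun n hn => by
    have := rankAt_add_le r h1 h2 hn
    have := h2 (n + 1)
    omega
  have hbdd : BddAbove (Set.range fun d => rankAt r (i + d) i) :=
    ⟨2 * y, by rintro _ ⟨d, rfl⟩; exact hb _ (by omega)⟩
  have hmono : Monotone fun d => rankAt r (i + d) i := fun d e hde =>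
    rankAt_mono (by omega) (by omega)
  have ht := tendsto_atTop_ciSup hmono hbdd
  refine ⟨⨆ d, rankAt r (i + d) i, ?_⟩
  rw [nhds_discrete, tendsto_pure] at ht
  filter_upwards [(tendsto_sub_atTop_nat i).eventually ht, eventually_ge_atTop i] with n hn hi
  rwa [Nat.add_sub_cancel' hi] at hn

/-- Injectivity passes to the limit from ranks at a fixed time. For surjectivity, once all new ranks
exceed v, the position holding rank v keeps it forever. -/
lemma HasSparseLowRanks.exists_perm (hr : HasSparseLowRanks r) :
    ∃ σ : Equiv.Perm ℕ, ∀ i, Tendsto (rankArray r i) atTop (𝓝 (σ i)) := by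
  choose f hf using hr.exists_limit
  refine ⟨Equiv.ofBijective f ⟨fun i j hij => ?_, fun v => ?_⟩,
    fun i => tendsto_rankArray_iff.2 (hf i)⟩
  · obtain ⟨n, h1, h2, h3, h4⟩ := ((hf i).and ((hf j).and
      ((eventually_ge_atTop i).and (eventually_ge_atTop j)))).exists
    exact rankAt_injOn r n (by simp; omega) (by simp; omega) (by omega)
  · obtain ⟨m, hm⟩ := eventually_atTop.1 (hr.eventually_lt v)
    set n := max m v with hn
    have hv : v ∈ (Finset.range (n + 1)).image (rankAt r n) := by
      rw [image_rankAt]; simp; omega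
    obtain ⟨i, hi, hiv⟩ := Finset.mem_image.1 hv
    rw [Finset.mem_range] at hi
    have hstay : ∀ k, n ≤ k → rankAt r k i = v := by
      intro k hk
      induction k, hk using Nat.le_induction with
      | base => exact hiv
      | succ k hk ih =>
        have := hm (k + 1) (by omega)
        rw [rankAt_succ r (by omega), ih, if_neg (by omega), add_zero]
    obtain ⟨k, hk1, hk2⟩ := ((hf i).and (eventually_ge_atTop n)).exists
    exact ⟨i, by rw [← hk1, hstay k hk2]⟩

variable {σ : Equiv.Perm ℕ}

/-- Later insertions shift ranks without changing relative orders, so the comparison is already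
decided when position j is inserted. -/
lemma limit_lt_limit_iff (hσ : ∀ i, Tendsto (rankArray r i) atTop (𝓝 (σ i)))
    {i j : ℕ} (h : i < j) : σ i < σ j ↔ rankAt r j i < r j := by
  obtain ⟨n, h1, h2, h3⟩ := ((tendsto_rankArray_iff.1 (hσ i)).and
    ((tendsto_rankArray_iff.1 (hσ j)).and (eventually_ge_atTop j))).exists
  rw [← h1, ← h2, rankAt_lt_iff_of_le r h.le le_rfl h3, rankAt_self]

lemma card_limit_lt (hσ : ∀ i, Tendsto (rankArray r i) atTop (𝓝 (σ i)))
    (i : ℕ) : ((Finset.range i).filter fun j => σ j < σ i).card = r i := by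
  rw [← card_rankAt_lt r i]
  congr 1
  refine Finset.filter_congr fun j hj => ?_
  exact limit_lt_limit_iff hσ (Finset.mem_range.1 hj)

lemma forall_limit_le_iff (hσ : ∀ i, Tendsto (rankArray r i) atTop (𝓝 (σ i)))
    (i : ℕ) : (∀ j ≤ i, σ j ≤ σ i) ↔ (r i : ℕ) = i := by
  have h := card_limit_lt hσ i
  have h' := Finset.card_filter_eq_iff (s := Finset.range i) (p := fun j => σ j < σ i)
  rw [h, Finset.card_range] at h'
  rw [h']
  simp only [Finset.mem_range]
  constructor
  · intro h j hj
    exact lt_of_le_of_ne (h j hj.le) fun e => hj.ne (σ.injective e)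
  · intro h j hj
    rcases hj.lt_or_eq with hj | rfl
    · exact (h j hj).le
    · exact le_rfl

lemma limit_le (hσ : ∀ i, Tendsto (rankArray r i) atTop (𝓝 (σ i)))
    {i y : ℕ} (hy : (r i : ℕ) ≤ y) (hc : ∀ n, lowRankCount r (2 * y) n ≤ y) :
    ∃ n, σ i ≤ r i + lowRankCount r (2 * y) n := by
  obtain ⟨n, h1, h2⟩ := ((tendsto_rankArray_iff.1 (hσ i)).and (eventually_ge_atTop i)).exists
  exact ⟨n + 1, h1 ▸ rankAt_add_le r hy hc h2⟩

lemma HasSparseLowRanks.eventually_limit_le (hr : HasSparseLowRanks r)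
    (hσ : ∀ i, Tendsto (rankArray r i) atTop (𝓝 (σ i)))
    {ε : ℝ} (hε : 0 < ε) :
    ∀ᶠ m : ℕ in atTop, (m : ℝ) ≤ (1 + ε) * r (σ.symm m) := by
  -- With ε ≤ 1 the sparsity bound ε·z also supplies the bound z that the bootstrap needs.
  wlog h1 : ε ≤ 1 generalizing ε
  · filter_upwards [this one_pos le_rfl] with m hm
    refine hm.trans ?_
    gcongr
    exact (not_le.1 h1).le
  obtain ⟨y, hy⟩ := eventually_atTop.1 (hr ε hε)
  have hc : ∀ z ≥ y, ∀ n, lowRankCount r (2 * z) n ≤ z := fun z hz n => by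
    have h : (lowRankCount r (2 * z) n : ℝ) ≤ z :=
      (hy z hz n).trans (by nlinarith [(Nat.cast_nonneg z : (0 : ℝ) ≤ z)])
    exact_mod_cast h
  filter_upwards [eventually_gt_atTop (2 * y)] with m hm
  set i := σ.symm m with hi
  have him : σ i = m := σ.apply_symm_apply m
  -- A rank below y would give σ i ≤ 2y < m. Hence r i is itself large enough to serve as the
  -- threshold in the bootstrap below.
  have hri : y ≤ r i := by
    by_contra hlt
    obtain ⟨n, hn⟩ := limit_le hσ (not_le.1 hlt).le (hc y le_rfl)
    have := hc y le_rfl n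
    omega
  obtain ⟨n, hn⟩ := limit_le hσ le_rfl (hc (r i) hri)
  have h2 := hy (r i) hri n
  rw [him] at hn
  have hn' : (m : ℝ) ≤ (r i : ℕ) + lowRankCount r (2 * (r i : ℕ)) n := by exact_mod_cast hn
  linarith

end Ranks

/-! ### Sums of independent indicators -/

/-- The moment generating function at 1 equals 1 + (e − 1)·μ(B), and e − 1 ≤ 2. -/
lemma mgf_indicator_one_le {Ω : Type*} [MeasurableSpace Ω] {μ : Measure Ω} [IsProbabilityMeasure μ]
    {B : Set Ω} (hB : MeasurableSet B) :
    mgf (B.indicator 1) μ 1 ≤ Real.exp (2 * μ.real B) := by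
  have h : (fun ω => Real.exp (1 * B.indicator (1 : Ω → ℝ) ω)) =
      fun ω => 1 + (Real.exp 1 - 1) * B.indicator (1 : Ω → ℝ) ω := by
    funext ω
    by_cases hω : ω ∈ B <;> simp [hω]
  have hint : Integrable (B.indicator (1 : Ω → ℝ)) μ :=
    (integrable_const (1 : ℝ)).indicator hB
  rw [mgf, h, integral_add (integrable_const _) (hint.const_mul _), integral_const_mul,
    integral_indicator_one hB]
  simp only [integral_const, probReal_univ, smul_eq_mul, one_mul]
  have h1 := Real.add_one_le_exp (2 * μ.real B)
  have h2 := Real.exp_one_lt_d9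
  nlinarith [measureReal_nonneg (μ := μ) (s := B)]

lemma measure_le_sum_indicator_le {Ω : Type*} [MeasurableSpace Ω] {μ : Measure Ω}
    [IsProbabilityMeasure μ] {B : ℕ → Set Ω} (hB : ∀ i, MeasurableSet (B i))
    (hind : iIndepFun (fun i => (B i).indicator (1 : Ω → ℝ)) μ) (m : ℝ) (s : Finset ℕ) :
    μ.real {ω | m ≤ ∑ i ∈ s, (B i).indicator 1 ω} ≤
      Real.exp (-m + 2 * ∑ i ∈ s, μ.real (B i)) := by
  have hmeas : ∀ i, Measurable ((B i).indicator (1 : Ω → ℝ)) := fun i =>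
    measurable_one.indicator (hB i)
  have hle : ∀ ω, |(∑ i ∈ s, (B i).indicator (1 : Ω → ℝ)) ω| ≤ s.card := by
    intro ω
    rw [Finset.sum_apply]
    refine (Finset.abs_sum_le_sum_abs _ _).trans ?_
    refine (Finset.sum_le_card_nsmul _ _ 1 fun i _ => ?_).trans (by simp)
    by_cases hω : ω ∈ B i <;> simp [hω]
  have hint : Integrable
      (fun ω => Real.exp (1 * (∑ i ∈ s, (B i).indicator (1 : Ω → ℝ)) ω)) μ := by
    refine Integrable.of_bound (C := Real.exp s.card) ?_ (ae_of_all _ fun ω => ?_)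
    · have : Measurable (∑ i ∈ s, (B i).indicator (1 : Ω → ℝ)) := by fun_prop
      exact (this.const_mul 1).exp.aestronglyMeasurable
    · rw [Real.norm_eq_abs, Real.abs_exp, one_mul]
      exact Real.exp_le_exp.2 ((le_abs_self _).trans (hle ω))
  have h := measure_ge_le_exp_mul_mgf m zero_le_one hint
  simp only [Finset.sum_apply] at h
  refine h.trans ?_
  rw [hind.mgf_sum hmeas, Real.exp_add, Finset.mul_sum, Real.exp_sum, neg_one_mul]
  gcongr with i
  · exact fun i _ => mgf_nonneg
  · exact mgf_indicator_one_le (hB i)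

/-- The partial sums increase with n, so continuity from below carries the Chernoff bound, which is
uniform in n, over to the union. -/
lemma measure_exists_le_sum_indicator_le {Ω : Type*} [MeasurableSpace Ω] {μ : Measure Ω}
    [IsProbabilityMeasure μ] {B : ℕ → Set Ω} (hB : ∀ i, MeasurableSet (B i))
    (hind : iIndepFun (fun i => (B i).indicator (1 : Ω → ℝ)) μ) {q : ℕ → ℝ}
    (hq : ∀ i, μ.real (B i) ≤ q i) (hsum : Summable q) (m : ℝ) :
    μ {ω | ∃ n, m ≤ ∑ i ∈ Finset.range n, (B i).indicator 1 ω} ≤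
      ENNReal.ofReal (Real.exp (-m + 2 * ∑' i, q i)) := by
  have hmono : Monotone fun n => {ω | m ≤ ∑ i ∈ Finset.range n, (B i).indicator (1 : Ω → ℝ) ω} := by
    intro n n' hn ω hω
    refine le_trans (α := ℝ) hω (Finset.sum_le_sum_of_subset_of_nonneg (Finset.range_mono hn) ?_)
    intro i _ _
    exact Set.indicator_nonneg (fun _ _ => zero_le_one) _
  have hU : {ω | ∃ n, m ≤ ∑ i ∈ Finset.range n, (B i).indicator (1 : Ω → ℝ) ω} =
      ⋃ n, {ω | m ≤ ∑ i ∈ Finset.range n, (B i).indicator (1 : Ω → ℝ) ω} := by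
    ext ω; simp
  rw [hU, hmono.measure_iUnion]
  refine iSup_le fun n => ?_
  rw [← ofReal_measureReal]
  refine ENNReal.ofReal_le_ofReal ((measure_le_sum_indicator_le hB hind m _).trans ?_)
  gcongr
  exact (Finset.sum_le_sum fun i _ => hq i).trans
    (hsum.sum_le_tsum _ fun i _ => measureReal_nonneg.trans (hq i))

/-! ### The law of the ranks -/

section RankLaw

variable {α : ℕ → ℕ∞}

/-- The law of a sequence of independent ranks. -/
noncomputable abbrev ranksLaw (α : ℕ → ℕ∞) : Measure ((i : ℕ) → Fin (i + 1)) :=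
  Measure.infinitePi fun i : ℕ => (rankLaw α i).toMeasure

lemma rankLaw_of_exists {i : ℕ} (h : ∃ k, α k = ((i + 1 : ℕ) : ℕ∞)) :
    rankLaw α (i + 1) = (PMF.uniformOfFintype (Fin (i + 1))).map Fin.castSucc := by
  rw [rankLaw, if_pos h]

lemma rankLaw_of_not_exists {i : ℕ} (h : ¬ ∃ k, α k = (i : ℕ∞)) :
    rankLaw α i = PMF.pure (Fin.last i) := by
  obtain _ | i := i
  · rfl
  · rw [rankLaw, if_neg h]

lemma ae_rankLaw_lt_iff (hα_pos : ∀ k, 1 ≤ α k) (i : ℕ) :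
    ∀ᵐ x ∂(rankLaw α i).toMeasure, ((x : Fin (i + 1)) : ℕ) < i ↔ ∃ k, α k = (i : ℕ∞) := by
  by_cases h : ∃ k, α k = (i : ℕ∞)
  · simp only [h, iff_true]
    obtain _ | i := i
    -- Index 0 has no non-maximal rank; it is excluded because the terms of α are at least 1.
    · obtain ⟨k, hk⟩ := h
      have := hα_pos k
      simp [hk] at this
    · rw [rankLaw_of_exists h, ← PMF.toMeasure_map _ _ .of_discrete]
      exact (ae_map_iff (by fun_prop) .of_discrete).2 (ae_of_all _ fun x => by simpa using x.is_le)
  · rw [rankLaw_of_not_exists h, PMF.toMeasure_pure]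
    simp [h]

lemma ae_ranksLaw_lt_iff (hα_pos : ∀ k, 1 ≤ α k) :
    ∀ᵐ r ∂ranksLaw α, ∀ i, (r i : ℕ) < i ↔ ∃ k, α k = (i : ℕ∞) := by
  rw [ae_all_iff]
  intro i
  exact (measurePreserving_eval_infinitePi (fun i => (rankLaw α i).toMeasure)
    i).quasiMeasurePreserving.ae (ae_rankLaw_lt_iff hα_pos i)

open Classical in
/-- An upper bound for the probability that position `i` is not maximal and has rank at most `z`,
divided by `z + 1`. -/
noncomputable def lowRankBound (α : ℕ → ℕ∞) (z i : ℕ) : ℝ :=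
  if ∃ k, α k = (i : ℕ∞) then min ((z : ℝ) + 1)⁻¹ (i : ℝ)⁻¹ else 0

/-- Choosing for each value an index at which α attains it gives an injection, so this is a
subseries of ∑ 1/α_k. -/
lemma summable_inv_of_exists_eq (hα_sum : ∑' k, ((α k : ℝ≥0∞))⁻¹ < ∞) :
    Summable fun i : {i : ℕ // ∃ k, α k = (i : ℕ∞)} => ((i : ℕ) : ℝ)⁻¹ := by
  let f (i : {i : ℕ // ∃ k, α k = (i : ℕ∞)}) : ℕ := i.2.choose
  have hf : ∀ i, α (f i) = ((i : ℕ) : ℕ∞) := fun i => i.2.choose_spec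
  have hinj : Function.Injective f := fun i j hij => by
    have h := hf i
    rw [hij, hf j, Nat.cast_inj] at h
    exact Subtype.ext h.symm
  have hle : ∑' i : {i : ℕ // ∃ k, α k = (i : ℕ∞)}, (((i : ℕ) : ℝ≥0∞))⁻¹ ≠ ∞ := by
    refine ne_top_of_le_ne_top hα_sum.ne ?_
    refine le_trans (le_of_eq (tsum_congr fun i => ?_))
      (ENNReal.tsum_comp_le_tsum_of_injective hinj _)
    rw [hf i, ENat.toENNReal_coe]
  refine (ENNReal.summable_toReal hle).congr fun i => ?_
  rw [ENNReal.toReal_inv, ENNReal.toReal_natCast]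

open Classical in
lemma summable_ite_inv (hα_sum : ∑' k, ((α k : ℝ≥0∞))⁻¹ < ∞) :
    Summable fun i : ℕ => if ∃ k, α k = (i : ℕ∞) then (i : ℝ)⁻¹ else 0 := by
  have h := (summable_subtype_iff_indicator (f := fun i : ℕ => (i : ℝ)⁻¹)
    (s := {i : ℕ | ∃ k, α k = (i : ℕ∞)})).1 (summable_inv_of_exists_eq hα_sum)
  refine h.congr fun i => ?_
  by_cases h : ∃ k, α k = (i : ℕ∞) <;> simp [Set.indicator, h]

lemma lowRankBound_nonneg (z i : ℕ) : 0 ≤ lowRankBound α z i := by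
  rw [lowRankBound]; split_ifs <;> positivity

lemma summable_lowRankBound (hα_sum : ∑' k, ((α k : ℝ≥0∞))⁻¹ < ∞) (z : ℕ) :
    Summable (lowRankBound α z) := by
  refine Summable.of_nonneg_of_le (lowRankBound_nonneg z) (fun i => ?_)
    (summable_ite_inv hα_sum)
  rw [lowRankBound]
  split_ifs <;> simp

/-- Each term is at most 1/(z+1), and the summable sequence 1/i over the terms i of α dominates.
Multiplied by z + 1, this says that the expected number of low ranks is o(z). -/
lemma tendsto_tsum_lowRankBound (hα_sum : ∑' k, ((α k : ℝ≥0∞))⁻¹ < ∞) :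
    Tendsto (fun z => ∑' i, lowRankBound α z i) atTop (𝓝 0) := by
  rw [← tsum_zero (α := ℝ) (β := ℕ)]
  refine tendsto_tsum_of_dominated_convergence (summable_ite_inv hα_sum) (fun i => ?_)
    (Eventually.of_forall fun z i => ?_)
  · refine squeeze_zero (fun z => lowRankBound_nonneg z i) (fun z => ?_)
      tendsto_one_div_add_atTop_nhds_zero_nat
    rw [lowRankBound]
    split_ifs
    · rw [one_div]; exact min_le_left _ _
    · positivity
  · rw [Real.norm_of_nonneg (lowRankBound_nonneg z i), lowRankBound]
    split_ifs <;> simp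

open Classical in
lemma rankLaw_real_low_le (z i : ℕ) :
    (rankLaw α i).toMeasure.real {x | (x : ℕ) < i ∧ (x : ℕ) ≤ z} ≤
      (z + 1) * lowRankBound α z i := by
  by_cases h : ∃ k, α k = (i : ℕ∞)
  · have hz : (0 : ℝ) < z + 1 := by positivity
    rw [lowRankBound, if_pos h, mul_min_of_nonneg _ _ hz.le, mul_inv_cancel₀ hz.ne']
    refine le_min measureReal_le_one ?_
    obtain _ | i := i
    -- Here the event is empty; the bound is 0 as well, since the inverse of 0 is 0.
    · simp
    · rw [rankLaw_of_exists h, measureReal_def, PMF.toMeasure_map_apply _ _ _ .of_discrete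
        .of_discrete, PMF.toMeasure_uniformOfFintype_apply _ .of_discrete]
      have hcard : Fintype.card ↑(Fin.castSucc ⁻¹'
          {x : Fin (i + 1 + 1) | (x : ℕ) < i + 1 ∧ (x : ℕ) ≤ z}) ≤ z + 1 := by
        have hinj : Function.Injective fun x : ↑(Fin.castSucc ⁻¹'
            {x : Fin (i + 1 + 1) | (x : ℕ) < i + 1 ∧ (x : ℕ) ≤ z}) =>
            (⟨(x : Fin (i + 1)), Nat.lt_succ_of_le x.2.2⟩ : Fin (z + 1)) := by
          intro x y hxy
          exact Subtype.ext (Fin.ext (Fin.mk.inj hxy))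
        simpa using Fintype.card_le_of_injective _ hinj
      rw [ENNReal.toReal_div, ENNReal.toReal_natCast, ENNReal.toReal_natCast, Fintype.card_fin,
        div_eq_mul_inv]
      gcongr
      exact_mod_cast hcard
  · rw [rankLaw_of_not_exists h, PMF.toMeasure_pure, lowRankBound, if_neg h, measureReal_def,
      Measure.dirac_apply' _ .of_discrete]
    simp

lemma ranksLaw_exists_le_lowRankCount_le (hα_sum : ∑' k, ((α k : ℝ≥0∞))⁻¹ < ∞)
    (z : ℕ) (m : ℝ) :
    ranksLaw α {r | ∃ n, m ≤ lowRankCount r z n} ≤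
      ENNReal.ofReal (Real.exp (-m + 2 * ((z + 1) * ∑' i, lowRankBound α z i))) := by
  let C (i : ℕ) : Set (Fin (i + 1)) := {x | (x : ℕ) < i ∧ (x : ℕ) ≤ z}
  let B (i : ℕ) : Set ((i : ℕ) → Fin (i + 1)) := (fun r => r i) ⁻¹' C i
  have hB : ∀ i, MeasurableSet (B i) := fun i => measurable_pi_apply i .of_discrete
  have hind : iIndepFun (fun i => (B i).indicator (1 : ((i : ℕ) → Fin (i + 1)) → ℝ))
      (ranksLaw α) :=
    iIndepFun_infinitePi (X := fun i => (C i).indicator (1 : Fin (i + 1) → ℝ))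
      fun i => .of_discrete
  have hq : ∀ i, (ranksLaw α).real (B i) ≤ (z + 1) * lowRankBound α z i := by
    intro i
    have := (measurePreserving_eval_infinitePi (fun i => (rankLaw α i).toMeasure) i).measureReal_preimage
      (s := C i) (MeasurableSet.of_discrete.nullMeasurableSet)
    exact this.trans_le (rankLaw_real_low_le z i)
  have h := measure_exists_le_sum_indicator_le hB hind hq
    ((summable_lowRankBound hα_sum z).mul_left _) m
  rw [tsum_mul_left] at h
  refine le_trans (le_of_eq ?_) h
  congr 1 with r
  refine exists_congr fun n => ?_
  rw [lowRankCount, Finset.card_filter]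
  push_cast
  simp [Set.indicator, B, C]

lemma ae_eventually_lowRankCount_le (hα_sum : ∑' k, ((α k : ℝ≥0∞))⁻¹ < ∞)
    {ε : ℝ} (hε : 0 < ε) :
    ∀ᵐ r ∂ranksLaw α, ∀ᶠ y : ℕ in atTop, ∀ n, (lowRankCount r (2 * y) n : ℝ) ≤ ε * y := by
  have h2 : Tendsto (fun y : ℕ => 2 * y) atTop atTop :=
    tendsto_id.const_mul_atTop' two_pos
  -- With W ≤ ε/12 and 2y + 1 ≤ 3y, the Chernoff exponent −εy + 2(2y+1)W is at most −εy/2, which is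
  -- summable after exponentiation.
  have hW := ((tendsto_tsum_lowRankBound hα_sum).comp h2).eventually
    (eventually_le_nhds (b := ε / 12) (by positivity))
  obtain ⟨y₀, hy₀⟩ := eventually_atTop.1 (hW.and (eventually_ge_atTop 1))
  have hsum : ∑' y : ℕ, ranksLaw α
      {r | ∃ n, ε * (y + y₀ : ℕ) ≤ lowRankCount r (2 * (y + y₀)) n} ≠ ∞ := by
    have hs : Summable fun y : ℕ => Real.exp (y * -(ε / 2)) :=
      Real.summable_exp_nat_mul_iff.2 (by linarith)
    refine ne_top_of_le_ne_top hs.tsum_ofReal_ne_top (ENNReal.tsum_le_tsum fun y => ?_)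
    refine (ranksLaw_exists_le_lowRankCount_le hα_sum _ _).trans
      (ENNReal.ofReal_le_ofReal (Real.exp_le_exp.2 ?_))
    obtain ⟨h3, h4⟩ := hy₀ (y + y₀) (by omega)
    simp only [Function.comp_apply] at h3
    have h5 : (1 : ℝ) ≤ (y + y₀ : ℕ) := by exact_mod_cast h4
    have h6 : (0 : ℝ) ≤ y₀ := by positivity
    set W := ∑' i, lowRankBound α (2 * (y + y₀)) i
    push_cast at h5 ⊢
    have h7 : (2 * ((y : ℝ) + y₀) + 1) * W ≤ (3 * (y + y₀)) * (ε / 12) := by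
      have : 0 ≤ W := tsum_nonneg fun i => lowRankBound_nonneg _ _
      gcongr
      linarith
    nlinarith
  filter_upwards [ae_eventually_notMem hsum] with r hr
  rw [← map_add_atTop_eq_nat y₀, eventually_map]
  filter_upwards [hr] with y hy n
  by_contra hlt
  exact hy ⟨n, (not_le.1 hlt).le⟩

theorem ae_hasSparseLowRanks (hα_sum : ∑' k, ((α k : ℝ≥0∞))⁻¹ < ∞) :
    ∀ᵐ r ∂ranksLaw α, HasSparseLowRanks r := by
  have h : ∀ᵐ r ∂ranksLaw α, ∀ k : ℕ, ∀ᶠ y : ℕ in atTop, ∀ n,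
      (lowRankCount r (2 * y) n : ℝ) ≤ 1 / ((k : ℝ) + 1) * y :=
    ae_all_iff.2 fun k => ae_eventually_lowRankCount_le hα_sum (by positivity)
  filter_upwards [h] with r hr ε hε
  obtain ⟨k, hk⟩ := exists_nat_one_div_lt hε
  filter_upwards [hr k] with y hy n
  refine (hy n).trans ?_
  gcongr

end RankLaw

/-! ### Orders with an initial segment of order type `ω` -/

namespace NatOrder

/-- The sequence `f` lists, in increasing order, an initial segment of the order `O`. -/
structure IsInitialList (O : NatOrder) (f : ℕ → ℕ) : Prop where
  injective : Function.Injective f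
  lt_iff : ∀ b i, O.lt b (f i) ↔ ∃ j < i, f j = b

lemma proj_inv_apply (O : NatOrder) (n : ℕ) (i : Fin n) :
    ((O.proj n)⁻¹ i : ℕ) = O.place n i := rfl

variable {O : NatOrder} {f : ℕ → ℕ}

lemma IsInitialList.place_eq (hf : O.IsInitialList f) {n i : ℕ} (hi : f i < n) :
    O.place n ⟨f i, hi⟩ = ((Finset.range i).filter fun j => f j < n).card := by
  rw [place, ← Finset.card_image_of_injective _ hf.injective, ← Set.ncard_coe_finset,
    ← Set.ncard_image_of_injective _ (Fin.val_injective (n := n))]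
  congr 1
  ext b
  simp only [Set.mem_image, Finset.coe_image, Finset.coe_filter, Finset.mem_range]
  constructor
  · rintro ⟨c, hc, rfl⟩
    obtain ⟨j, hj, hjc⟩ := (hf.lt_iff _ _).1 hc
    exact ⟨j, ⟨hj, hjc ▸ c.2⟩, hjc⟩
  · rintro ⟨j, ⟨hj, hjn⟩, rfl⟩
    exact ⟨⟨f j, hjn⟩, (hf.lt_iff _ _).2 ⟨j, hj, rfl⟩, rfl⟩

/-- Once n exceeds f 0, …, f i, restricting to numbers below n drops none of the predecessors of f
i; this is why initial stretches of π_n stabilize. -/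
lemma IsInitialList.place_eq_self (hf : O.IsInitialList f) {n i : ℕ} (h : ∀ j ≤ i, f j < n) :
    O.place n ⟨f i, h i le_rfl⟩ = i := by
  rw [hf.place_eq, Finset.filter_true_of_mem fun j hj => h j (Finset.mem_range.1 hj).le,
    Finset.card_range]

lemma IsInitialList.lt_of_forall_lt (hf : O.IsInitialList f) {n i : ℕ} (h : ∀ j ≤ i, f j < n) :
    i < n := by
  have := O.place_lt n ⟨f i, h i le_rfl⟩
  rwa [hf.place_eq_self h] at this

lemma IsInitialList.proj_apply (hf : O.IsInitialList f) {n : ℕ} {i : Fin n}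
    (h : ∀ j ≤ (i : ℕ), f j < n) : (O.proj n i : ℕ) = f i := by
  have : O.proj n i = ⟨f i, h i le_rfl⟩ := by
    rw [← Equiv.Perm.eq_inv_iff_eq]
    exact Fin.ext (hf.place_eq_self h).symm
  rw [this]

lemma IsInitialList.isRecord_proj_iff (hf : O.IsInitialList f) {n : ℕ} {i : Fin n}
    (h : ∀ j ≤ (i : ℕ), f j < n) :
    IsRecord (O.proj n) i ↔ ∀ j ≤ (i : ℕ), f j ≤ f i := by
  have hle : ∀ j : Fin n, j ≤ i → (O.proj n j : ℕ) = f j := fun j hj =>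
    hf.proj_apply fun k hk => h k (hk.trans hj)
  constructor
  · intro hr j hj
    have := hr ⟨j, hj.trans_lt i.2⟩ hj
    rwa [Fin.le_def, hle _ hj, hle _ le_rfl] at this
  · intro hr j hj
    rw [Fin.le_def, hle _ hj, hle _ le_rfl]
    exact hr j hj

end NatOrder

/-! ### Convergence of the non-record positions. -/

section NonRecord

variable {α : ℕ → ℕ∞}

lemma lt_of_lt_of_ne_top (hα_strict : ∀ k, α k < α (k + 1) ∨ (α k = ⊤ ∧ α (k + 1) = ⊤))
    {k l : ℕ} (h : k < l) (hk : α k ≠ ⊤) : α k < α l := by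
  induction l, h using Nat.le_induction with
  | base => exact (hα_strict k).resolve_right fun h => hk h.1
  | succ l hl ih =>
    rcases hα_strict l with h | h
    · exact ih.trans h
    · rw [h.2]; exact lt_top_iff_ne_top.2 hk

/-- The terms of α below α k are α 0, …, α (k − 1), which are finite and distinct. -/
lemma ncard_lt_of_eq (hα_strict : ∀ k, α k < α (k + 1) ∨ (α k = ⊤ ∧ α (k + 1) = ⊤))
    {k j : ℕ} (h : α k = (j : ℕ∞)) : {i : ℕ | i < j ∧ ∃ l, α l = (i : ℕ∞)}.ncard = k := by
  have hmono : Monotone α := monotone_nat_of_le_succ fun k => by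
    rcases hα_strict k with h | h
    · exact h.le
    · rw [h.1, h.2]
  have hne : ∀ l < k, α l ≠ ⊤ := fun l hl htop => by
    have := hmono hl.le
    rw [htop, h, top_le_iff] at this
    exact ENat.natCast_ne_top _ this
  have himage : {i : ℕ | i < j ∧ ∃ l, α l = (i : ℕ∞)} = (fun l => (α l).toNat) '' Set.Iio k := by
    ext i
    simp only [Set.mem_image, Set.mem_Iio]
    constructor
    · rintro ⟨hij, l, hl⟩
      refine ⟨l, ?_, by rw [hl, ENat.toNat_natCast]⟩
      by_contra! hkl
      have := hmono hkl
      rw [hl, h] at this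
      have : j ≤ i := by exact_mod_cast this
      omega
    · rintro ⟨l, hl, rfl⟩
      have h1 := ENat.natCast_toNat (hne l hl)
      refine ⟨?_, l, h1.symm⟩
      have h2 := lt_of_lt_of_ne_top hα_strict hl (hne l hl)
      rw [h, ← h1] at h2
      exact_mod_cast h2
  rw [himage, Set.InjOn.ncard_image, Set.ncard_Iio_nat]
  intro l hl l' hl' heq
  simp only [Set.mem_Iio] at hl hl'
  have heq' : α l = α l' := by
    rw [← ENat.natCast_toNat (hne l hl), ← ENat.natCast_toNat (hne l' hl')]
    exact congrArg _ heq
  rcases lt_trichotomy l l' with h | h | h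
  · exact absurd heq' (lt_of_lt_of_ne_top hα_strict h (hne l hl)).ne
  · exact h
  · exact absurd heq' (lt_of_lt_of_ne_top hα_strict h (hne l' hl')).ne'

lemma exists_eq_and_ncard_eq_iff
    (hα_strict : ∀ k, α k < α (k + 1) ∨ (α k = ⊤ ∧ α (k + 1) = ⊤)) {k j : ℕ} :
    ((∃ l, α l = (j : ℕ∞)) ∧ {i : ℕ | i < j ∧ ∃ l, α l = (i : ℕ∞)}.ncard = k) ↔
      α k = (j : ℕ∞) := by
  constructor
  · rintro ⟨⟨l, hl⟩, rfl⟩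
    rwa [ncard_lt_of_eq hα_strict hl]
  · intro h
    exact ⟨⟨k, h⟩, ncard_lt_of_eq hα_strict h⟩

variable {O : NatOrder} {f : ℕ → ℕ}

lemma NatOrder.IsInitialList.nonRecord_iff (hf : O.IsInitialList f)
    (hα_strict : ∀ k, α k < α (k + 1) ∨ (α k = ⊤ ∧ α (k + 1) = ⊤))
    (hα : ∀ j, (∀ i ≤ j, f i ≤ f j) ↔ ¬ ∃ k, α k = (j : ℕ∞)) {n k : ℕ} {j : Fin n}
    (h : ∀ i ≤ (j : ℕ), f i < n) :
    (¬ IsRecord (O.proj n) j ∧ {i : Fin n | i < j ∧ ¬ IsRecord (O.proj n) i}.ncard = k) ↔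
      α k = ((j : ℕ) : ℕ∞) := by
  have h1 : ∀ i ≤ j, ¬ IsRecord (O.proj n) i ↔ ∃ k, α k = ((i : ℕ) : ℕ∞) := fun i hi => by
    rw [hf.isRecord_proj_iff fun l hl => h l (hl.trans hi), hα, not_not]
  rw [← exists_eq_and_ncard_eq_iff hα_strict, h1 j le_rfl,
    ← Set.ncard_image_of_injective _ (Fin.val_injective (n := n))]
  have h2 : Fin.val '' {i : Fin n | i < j ∧ ¬ IsRecord (O.proj n) i} =
      {i : ℕ | i < (j : ℕ) ∧ ∃ l, α l = (i : ℕ∞)} := by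
    ext i
    simp only [Set.mem_image]
    constructor
    · rintro ⟨i, ⟨h3, h4⟩, rfl⟩
      exact ⟨h3, (h1 i h3.le).1 h4⟩
    · rintro ⟨h3, h4⟩
      exact ⟨⟨i, h3.trans j.2⟩, ⟨h3, (h1 ⟨i, h3.trans j.2⟩ (Fin.le_def.2 h3.le)).2 h4⟩, rfl⟩
  rw [h2]

lemma eventually_forall_le_lt (f : ℕ → ℕ) (m : ℕ) : ∀ᶠ n in atTop, ∀ j ≤ m, f j < n := by
  filter_upwards [eventually_gt_atTop ((Finset.range (m + 1)).sup f)] with n hn j hj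
  exact (Finset.le_sup (f := f) (Finset.mem_range.2 (by omega))).trans_lt hn

theorem NatOrder.IsInitialList.tendsto_nonRecordPosition (hf : O.IsInitialList f)
    (hα_strict : ∀ k, α k < α (k + 1) ∨ (α k = ⊤ ∧ α (k + 1) = ⊤))
    (hα : ∀ j, (∀ i ≤ j, f i ≤ f j) ↔ ¬ ∃ k, α k = (j : ℕ∞)) (k : ℕ) :
    Tendsto (fun n => nonRecordPosition (O.proj n) k) atTop (𝓝 (α k + 1)) := by
  -- No index below m ≤ α k can be the sought non-record. Arbitrary m settles the case α k = ⊤; for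
  -- finite α k, taking m = α k gives one inequality and the position m itself the other.
  have hge : ∀ n m : ℕ, (∀ j ≤ m, f j < n) → (m : ℕ∞) ≤ α k →
      (m : ℕ∞) + 1 ≤ nonRecordPosition (O.proj n) k := by
    intro n m hm hmk
    refine le_iInf₂ fun j hj => ?_
    gcongr
    by_contra! hjm
    have := (hf.nonRecord_iff hα_strict hα fun i hi => hm i (hi.trans hjm.le)).1 hj
    rw [this] at hmk
    have : m ≤ (j : ℕ) := by exact_mod_cast hmk
    omega
  cases hk : α k with
  | top =>
    rw [top_add, ENat.tendsto_nhds_top_iff_natCast_lt]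
    intro m
    filter_upwards [eventually_forall_le_lt f m] with n hn
    refine lt_of_lt_of_le ?_ (hge n m hn (hk ▸ le_top))
    exact_mod_cast m.lt_succ_self
  | coe m =>
    refine tendsto_const_nhds.congr' ?_
    filter_upwards [eventually_forall_le_lt f m] with n hn
    refine le_antisymm (hge n m hn hk.ge) ?_
    exact iInf₂_le (⟨m, hf.lt_of_forall_lt hn⟩ : Fin n)
      ((hf.nonRecord_iff hα_strict hα (j := ⟨m, hf.lt_of_forall_lt hn⟩) hn).2 hk)

end NonRecord

/-! ### The combined order -/

section Combine

variable {s : ℕ → Bool}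

/-- N₁ precedes N₂ and has order type ω: its i-th element in the order is the one with index σ i in
the increasing enumeration. -/
lemma isInitialList_combine (hs : {i | s i = true}.Infinite) (σ : Equiv.Perm ℕ) (O₂ : NatOrder) :
    (NatOrder.combine s (NatOrder.ofPerm σ) O₂).IsInitialList
      fun i => Nat.nth (s · = true) (σ i) := by
  refine ⟨(Nat.nth_injective hs).comp σ.injective, fun b i => ?_⟩
  have h1 : s (Nat.nth (s · = true) (σ i)) = true := Nat.nth_mem_of_infinite hs _
  simp only [NatOrder.combine, NatOrder.ofPerm, h1, Nat.count_nth_of_infinite hs,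
    Equiv.symm_apply_apply]
  constructor
  · intro h
    simp only [Bool.true_eq_false, and_false, true_and, false_or, false_and, or_false] at h
    exact ⟨_, h.2, by rw [Equiv.apply_symm_apply, Nat.nth_count h.1]⟩
  · rintro ⟨j, hj, rfl⟩
    refine Or.inr (Or.inl ⟨Nat.nth_mem_of_infinite hs _, trivial, ?_⟩)
    rwa [Nat.count_nth_of_infinite hs, Equiv.symm_apply_apply]

variable {r : (i : ℕ) → Fin (i + 1)} {σ : Equiv.Perm ℕ}

/-- The smaller numbers preceding n correspond to the positions j < i with σ j < σ i, and
`card_limit_lt` counts them. -/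
lemma place_combine_of_true (hσ : ∀ i, Tendsto (rankArray r i) atTop (𝓝 (σ i)))
    (hs : {i | s i = true}.Infinite) (O₂ : NatOrder) {n : ℕ} (hn : s n = true) :
    (NatOrder.combine s (NatOrder.ofPerm σ) O₂).place (n + 1) (Fin.last n) =
      r (σ.symm (Nat.count (s · = true) n)) := by
  set i := σ.symm (Nat.count (s · = true) n) with hi
  have hin : Nat.nth (s · = true) (σ i) = n := by
    rw [hi, Equiv.apply_symm_apply, Nat.nth_count hn]
  have h := (isInitialList_combine hs σ O₂).place_eq (n := n + 1) (i := i) (by omega)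
  have hlast : Fin.last n = ⟨Nat.nth (s · = true) (σ i), by omega⟩ := Fin.ext hin.symm
  rw [hlast, h, ← card_limit_lt hσ i]
  congr 1
  refine Finset.filter_congr fun j hj => ?_
  have hne : σ j ≠ σ i := fun e => (Finset.mem_range.1 hj).ne (σ.injective e)
  have h2 : Nat.nth (s · = true) (σ j) ≤ n ↔ σ j ≤ σ i := by
    conv_lhs => rw [← hin]
    exact Nat.nth_le_nth hs
  rw [Nat.lt_succ_iff, h2]
  omega

lemma count_le_place_combine_of_false (O₁ O₂ : NatOrder) {n : ℕ} (hn : s n = false) :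
    Nat.count (s · = true) n ≤ (NatOrder.combine s O₁ O₂).place (n + 1) (Fin.last n) := by
  rw [NatOrder.place, Nat.count_eq_card_filter_range, ← Set.ncard_coe_finset,
    ← Set.ncard_image_of_injective _ (Fin.val_injective (n := n + 1))]
  refine Set.ncard_le_ncard ?_ (Set.toFinite _)
  intro j hj
  simp only [Finset.coe_filter, Finset.mem_range] at hj
  exact ⟨⟨j, hj.1.trans n.lt_succ_self⟩, Or.inl ⟨hj.2, hn⟩, rfl⟩

lemma liminf_eq_of_forall_pos {u : ℕ → ℝ} {c : ℝ} (h₁ : ∀ ε > 0, ∀ᶠ n in atTop, c - ε ≤ u n)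
    (h₂ : ∀ ε > 0, ∃ᶠ n in atTop, u n ≤ c + ε) : liminf u atTop = c := by
  have hb : IsBoundedUnder (· ≥ ·) atTop u := ⟨c - 1, h₁ 1 one_pos⟩
  have hc : IsCoboundedUnder (· ≥ ·) atTop u := IsCoboundedUnder.of_frequently_le (h₂ 1 one_pos)
  refine le_antisymm ?_ ?_
  · exact le_of_forall_pos_le_add fun ε hε => liminf_le_of_frequently_le (h₂ ε hε) hb
  · refine le_of_forall_pos_le_add fun ε hε => ?_
    linarith [le_liminf_of_le hc (h₁ ε hε)]

theorem liminf_place_combine (hr : HasSparseLowRanks r)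
    (hσ : ∀ i, Tendsto (rankArray r i) atTop (𝓝 (σ i))) (hs : {i | s i = true}.Infinite)
    {p : ℝ} (hp : Tendsto (fun n : ℕ => (Nat.count (s · = true) n : ℝ) / n) atTop (𝓝 p))
    (O₂ : NatOrder) :
    liminf (fun n : ℕ => ((((((NatOrder.combine s (NatOrder.ofPerm σ) O₂).proj (n + 1))⁻¹
      (Fin.last n) : Fin (n + 1)) : ℕ) + 1 : ℕ) : ℝ) / ((n + 1 : ℕ) : ℝ)) atTop = p := by
  set O := NatOrder.combine s (NatOrder.ofPerm σ) O₂ with hO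
  simp only [NatOrder.proj_inv_apply]
  set c : ℕ → ℕ := fun n => Nat.count (s · = true) n with hc
  have hinv : Tendsto (fun n : ℕ => 1 / ((n : ℝ) + 1)) atTop (𝓝 0) :=
    tendsto_one_div_add_atTop_nhds_zero_nat
  have hc0 : Tendsto (fun n : ℕ => (c n : ℝ) / ((n + 1 : ℕ) : ℝ)) atTop (𝓝 p) := by
    have h := hp.mul (tendsto_const_nhds (x := (1 : ℝ)).sub hinv)
    rw [sub_zero, mul_one] at h
    refine h.congr' ?_
    filter_upwards [eventually_gt_atTop 0] with n hn
    have : (n : ℝ) ≠ 0 := by positivity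
    push_cast
    field_simp
    simp only [add_sub_cancel_right, hc]
    ring
  have hc1 : Tendsto (fun n : ℕ => ((c n + 1 : ℕ) : ℝ) / ((n + 1 : ℕ) : ℝ)) atTop (𝓝 p) := by
    have h := hc0.add hinv
    rw [add_zero] at h
    refine h.congr fun n => ?_
    push_cast
    rw [add_div]
  have hctop : Tendsto c atTop atTop := by
    refine tendsto_atTop_atTop.2 fun b => ⟨Nat.nth (s · = true) b, fun n hn => ?_⟩
    rw [← Nat.count_nth_of_infinite hs b]
    exact Nat.count_monotone _ hn
  refine liminf_eq_of_forall_pos (fun ε hε => ?_) (fun ε hε => ?_)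
  · filter_upwards [hctop.eventually (hr.eventually_limit_le hσ (half_pos hε)),
      hc0.eventually (eventually_ge_nhds (show p - ε / 2 < p by linarith))] with n h1 h2
    have hcn : (c n : ℝ) ≤ ((n + 1 : ℕ) : ℝ) := by
      exact_mod_cast (Nat.count_le (p := (s · = true))).trans n.le_succ
    have hn : (0 : ℝ) < ((n + 1 : ℕ) : ℝ) := by positivity
    have hplace : (c n : ℝ) ≤ (1 + ε / 2) * O.place (n + 1) (Fin.last n) := by
      cases hsn : s n with
      | true => rw [place_combine_of_true hσ hs O₂ hsn]; exact h1
      | false =>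
        have h3 : (c n : ℝ) ≤ O.place (n + 1) (Fin.last n) := by
          exact_mod_cast count_le_place_combine_of_false _ _ hsn
        have h4 : (0 : ℝ) ≤ O.place (n + 1) (Fin.last n) := by positivity
        nlinarith
    -- This turns the factor 1 + ε/2 into an additive error of at most (ε/2)(n+1); the other ε/2 is
    -- spent on c n/(n+1) → p.
    have hplace' : (O.place (n + 1) (Fin.last n) : ℝ) ≤ ((n + 1 : ℕ) : ℝ) := by
      exact_mod_cast (O.place_lt _ _).le
    rw [le_div_iff₀ hn] at h2 ⊢
    push_cast at *
    nlinarith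
  · have hfreq : ∃ᶠ n in atTop, s n = true := Nat.frequently_atTop_iff_infinite.2 hs
    refine (hfreq.and_eventually (hc1.eventually
      (eventually_le_nhds (show p < p + ε by linarith)))).mono fun n hn => ?_
    refine le_trans ?_ hn.2
    rw [place_combine_of_true hσ hs O₂ hn.1]
    gcongr
    -- Ranks only increase with time, so the initial rank is at most the limit, which is c n.
    obtain ⟨m, h1, h2⟩ := ((tendsto_rankArray_iff.1 (hσ (σ.symm (c n)))).and
      (eventually_ge_atTop (σ.symm (c n)))).exists
    rw [Equiv.apply_symm_apply] at h1
    rw [← rankAt_self r, ← h1]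
    exact rankAt_mono le_rfl h2

end Combine

/-! ### Measurability of the projections -/

namespace NatOrder

lemma proj_eq_iff (O : NatOrder) {n : ℕ} (τ : Equiv.Perm (Fin n)) :
    O.proj n = τ ↔ ∀ i j : Fin n, O.lt i j ↔ τ⁻¹ i < τ⁻¹ j := by
  constructor
  · rintro rfl i j
    exact (O.proj_inv_lt_iff n i j).symm
  · intro h
    rw [← inv_inj]
    ext i
    -- A strictly monotone permutation of `Fin n` is the identity.
    have hmono : StrictMono (τ⁻¹ * O.proj n) := fun a b hab => by
      rw [Equiv.Perm.mul_apply, Equiv.Perm.mul_apply, ← h, ← O.proj_inv_lt_iff]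
      simpa using hab
    have h1 := congrFun ((hmono.range_inj strictMono_id).1
      (by rw [Set.range_id, (τ⁻¹ * O.proj n).surjective.range_eq])) ((O.proj n)⁻¹ i)
    have h2 : O.proj n ((O.proj n)⁻¹ i) = i := (O.proj n).apply_symm_apply i
    rw [Equiv.Perm.mul_apply, h2] at h1
    rw [h1, id]

/-- The projection takes finitely many values, and each fibre is a finite intersection of conditions
on precedence events. -/
lemma measurable_comp_proj {X : Type*} [MeasurableSpace X] (n : ℕ)
    (g : Equiv.Perm (Fin n) → X) : Measurable fun O : NatOrder => g (O.proj n) := by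
  let : MeasurableSpace (Equiv.Perm (Fin n)) := ⊤
  refine Measurable.comp (g := g) (fun _ _ => trivial) (measurable_to_countable' fun τ => ?_)
  have : (fun O : NatOrder => O.proj n) ⁻¹' {τ} =
      ⋂ i : Fin n, ⋂ j : Fin n, {O : NatOrder | O.lt i j ↔ τ⁻¹ i < τ⁻¹ j} := by
    ext O
    simpa using O.proj_eq_iff τ
  rw [this]
  refine .iInter fun i => .iInter fun j => ?_
  exact (measurableSet_precedes i j).iff (.const _)

end NatOrder

/-! ### The random splitting -/

lemma ae_tendsto_count_div (p : unitInterval) :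
    ∀ᵐ s ∂(Measure.infinitePi fun _ : ℕ => bernoulliMeasure true false p),
      Tendsto (fun n : ℕ => (Nat.count (s · = true) n : ℝ) / n) atTop (𝓝 (p : ℝ)) := by
  let P : Measure (ℕ → Bool) := Measure.infinitePi fun _ : ℕ => bernoulliMeasure true false p
  let g : Bool → ℝ := fun b => if b = true then 1 else 0
  have hg : Measurable g := .of_discrete
  have hX : ∀ i, Measurable fun s : ℕ → Bool => g (s i) := fun i =>
    hg.comp (measurable_pi_apply i)
  have hlaw : ∀ i, P.map (fun s : ℕ → Bool => g (s i)) =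
      (bernoulliMeasure true false p).map g := fun i => by
    rw [← Measure.infinitePi_map_eval (fun _ : ℕ => bernoulliMeasure true false p) i,
      Measure.map_map hg (measurable_pi_apply i)]
    rfl
  have hint : Integrable (fun s : ℕ → Bool => g (s 0)) P := by
    refine Integrable.of_bound (C := 1) (hX 0).aestronglyMeasurable (ae_of_all _ fun s => ?_)
    cases h : s 0 <;> simp [g]
  have hind : iIndepFun (fun i (s : ℕ → Bool) => g (s i)) P :=
    iIndepFun_infinitePi (X := fun _ => g) fun _ => hg
  have h := strong_law_ae_real (μ := P) (fun i s => g (s i)) hint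
    (fun i j hij => hind.indepFun hij)
    fun i => ⟨(hX i).aemeasurable, (hX 0).aemeasurable, by rw [hlaw, hlaw]⟩
  have hmean : ∫ s, g (s 0) ∂P = p := by
    have h1 := integral_map (μ := P) (φ := fun s : ℕ → Bool => s 0) (f := g)
      (measurable_pi_apply 0).aemeasurable hg.aestronglyMeasurable
    rw [← h1, Measure.infinitePi_map_eval (fun _ : ℕ => bernoulliMeasure true false p) 0,
      integral_bernoulliMeasure]
    simp [g]
  rw [hmean] at h
  filter_upwards [h] with s hs
  refine hs.congr fun n => ?_
  rw [Nat.count_eq_card_filter_range, Finset.card_filter]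
  push_cast
  rfl

lemma infinite_of_tendsto_count_div {s : ℕ → Bool} {p : ℝ} (hp : 0 < p)
    (h : Tendsto (fun n : ℕ => (Nat.count (s · = true) n : ℝ) / n) atTop (𝓝 p)) :
    {i | s i = true}.Infinite := by
  intro hfin
  have h0 : Tendsto (fun n : ℕ => (Nat.count (s · = true) n : ℝ) / n) atTop (𝓝 0) := by
    refine squeeze_zero (fun n => by positivity) (fun n => ?_)
      (tendsto_const_div_atTop_nhds_zero_nat (hfin.toFinset.card : ℝ))
    gcongr
    rw [Nat.count_eq_card_filter_range]
    exact Finset.card_le_card fun i hi => by simpa using (Finset.mem_filter.1 hi).2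
  exact hp.ne (tendsto_nhds_unique h0 h)

/-! ### The main theorem -/

lemma mixedMeasure_eq_map (α : ℕ → ℕ∞) (p : unitInterval) :
    mixedMeasure α p =
      ((Measure.infinitePi fun _ : ℕ => bernoulliMeasure true false p).prod
        ((ranksLaw α).prod exchangeableMeasure)).map
          fun x => NatOrder.combine x.1 (NatOrder.ofRanks x.2.1) x.2.2 := by
  have h1 : (rankMeasure α).prod exchangeableMeasure =
      ((ranksLaw α).prod exchangeableMeasure).map (Prod.map NatOrder.ofRanks id) := by
    rw [← Measure.map_prod_map _ _ NatOrder.measurable_ofRanks measurable_id, Measure.map_id]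
    rfl
  have hm : Measurable (Prod.map NatOrder.ofRanks (id : NatOrder → NatOrder)) :=
    NatOrder.measurable_ofRanks.prodMap measurable_id
  have h2 := Measure.map_prod_map (Measure.infinitePi fun _ : ℕ => bernoulliMeasure true false p)
    ((ranksLaw α).prod exchangeableMeasure) measurable_id hm
  rw [Measure.map_id] at h2
  rw [mixedMeasure, h1, h2, Measure.map_map NatOrder.measurable_combine
    (measurable_id.prodMap hm)]
  rfl

lemma NatOrder.exists_ofRanks_eq {r : (i : ℕ) → Fin (i + 1)} (hr : HasSparseLowRanks r) :
    ∃ σ : Equiv.Perm ℕ, (∀ i, Tendsto (rankArray r i) atTop (𝓝 (σ i))) ∧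
      NatOrder.ofRanks r = NatOrder.ofPerm σ :=
  ⟨_, hr.exists_perm.choose_spec, by rw [NatOrder.ofRanks, dif_pos hr.exists_perm]⟩

/-- All the probability is collected here: the strong law for the splitting and the sparsity of the
ranks hold almost surely on the product space, which leaves a deterministic claim for the combined
order with arbitrary O₂. -/
lemma ae_mixedMeasure_of_forall {α : ℕ → ℕ∞} (hα_pos : ∀ k, 1 ≤ α k)
    (hα_sum : ∑' k, ((α k : ℝ≥0∞))⁻¹ < ∞) {p : unitInterval} (hp : 0 < p) {Q : NatOrder → Prop}
    (hQ : MeasurableSet {O | Q O})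
    (h : ∀ (s : ℕ → Bool) (r : (i : ℕ) → Fin (i + 1)) (σ : Equiv.Perm ℕ) (O₂ : NatOrder),
      {i | s i = true}.Infinite →
      Tendsto (fun n : ℕ => (Nat.count (s · = true) n : ℝ) / n) atTop (𝓝 (p : ℝ)) →
      HasSparseLowRanks r → (∀ i, (r i : ℕ) < i ↔ ∃ k, α k = (i : ℕ∞)) →
      (∀ i, Tendsto (rankArray r i) atTop (𝓝 (σ i))) →
      Q (NatOrder.combine s (NatOrder.ofPerm σ) O₂)) :
    ∀ᵐ O ∂mixedMeasure α p, Q O := by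
  have hm : Measurable fun x : (ℕ → Bool) × ((i : ℕ) → Fin (i + 1)) × NatOrder =>
      NatOrder.combine x.1 (NatOrder.ofRanks x.2.1) x.2.2 :=
    NatOrder.measurable_combine.comp
      (measurable_id.prodMap (NatOrder.measurable_ofRanks.prodMap measurable_id))
  rw [mixedMeasure_eq_map, ae_map_iff hm.aemeasurable hQ]
  have h1 := (Measure.quasiMeasurePreserving_fst (μ := Measure.infinitePi fun _ : ℕ =>
    bernoulliMeasure true false p) (ν := (ranksLaw α).prod exchangeableMeasure)).ae
      (ae_tendsto_count_div p)
  have h2 := (Measure.quasiMeasurePreserving_snd (μ := Measure.infinitePi fun _ : ℕ =>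
    bernoulliMeasure true false p) (ν := (ranksLaw α).prod exchangeableMeasure)).ae
      ((Measure.quasiMeasurePreserving_fst (μ := ranksLaw α) (ν := exchangeableMeasure)).ae
        ((ae_hasSparseLowRanks hα_sum).and (ae_ranksLaw_lt_iff hα_pos)))
  filter_upwards [h1, h2] with x hx1 hx2
  obtain ⟨σ, hσ, he⟩ := NatOrder.exists_ofRanks_eq hx2.1
  rw [he]
  exact h _ _ σ _ (infinite_of_tendsto_count_div (by exact_mod_cast hp) hx1) hx1 hx2.1 hx2.2 hσ

theorem mainTheorem3
    (α : ℕ → ℕ∞) (hα_pos : ∀ k, 1 ≤ α k)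
    (hα_strict : ∀ k, α k < α (k + 1) ∨ (α k = ⊤ ∧ α (k + 1) = ⊤))
    (hα_sum : ∑' k, ((α k : ℝ≥0∞))⁻¹ < ∞)
    (p : unitInterval) (hp : 0 < p)
    {Ω : Type*} [MeasurableSpace Ω] (μ : Measure Ω) (O : Ω → NatOrder)
    (hO : HasLaw O (mixedMeasure α p) μ) :
    (∀ᵐ ω ∂μ, ∀ k : ℕ,
      Tendsto (fun n : ℕ => nonRecordPosition ((O ω).proj n) k) atTop (𝓝 (α k + 1))) ∧
    (∀ᵐ ω ∂μ,
      liminf (fun n : ℕ => (((((O ω).proj (n + 1))⁻¹ (Fin.last n) : ℕ) + 1 : ℕ) : ℝ) /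
        ((n + 1 : ℕ) : ℝ)) atTop = (p : ℝ)) := by
  constructor
  · rw [ae_all_iff]
    intro k
    refine ae_of_ae_map hO.aemeasurable (p := fun O : NatOrder =>
      Tendsto (fun n : ℕ => nonRecordPosition (O.proj n) k) atTop (𝓝 (α k + 1))) ?_
    rw [hO.map_eq]
    refine ae_mixedMeasure_of_forall hα_pos hα_sum hp ?_ ?_
    · have : (𝓝 (α k + 1)).IsMeasurablyGenerated :=
        ⟨fun t ht => ⟨t, ht, .of_discrete, subset_rfl⟩⟩
      exact measurableSet_tendsto _ fun n =>
        NatOrder.measurable_comp_proj n fun τ => nonRecordPosition τ k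
    · intro s r σ O₂ hs _ _ hr hσ
      refine (isInitialList_combine hs σ O₂).tendsto_nonRecordPosition hα_strict (fun j => ?_) k
      -- The increasing enumeration of N₁ preserves comparisons, so the records of the list are
      -- those of σ, which occur where r j = j.
      simp only [Nat.nth_le_nth hs]
      rw [forall_limit_le_iff hσ, ← hr j]
      have := (r j).is_le
      omega
  · refine ae_of_ae_map hO.aemeasurable (p := fun O : NatOrder =>
      liminf (fun n : ℕ => ((((O.proj (n + 1))⁻¹ (Fin.last n) : ℕ) + 1 : ℕ) : ℝ) /
        ((n + 1 : ℕ) : ℝ)) atTop = (p : ℝ)) ?_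
    rw [hO.map_eq]
    refine ae_mixedMeasure_of_forall hα_pos hα_sum hp ?_ ?_
    · refine measurableSet_eq_fun (Measurable.liminf fun n => ?_) measurable_const
      exact NatOrder.measurable_comp_proj (n + 1) fun τ =>
        (((τ⁻¹ (Fin.last n) : ℕ) + 1 : ℕ) : ℝ) / ((n + 1 : ℕ) : ℝ)
    · intro s r σ O₂ hs hcount hsparse _ hσ
      exact liminf_place_combine hsparse hσ hs hcount O₂
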